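/- Let $k\ge 1$ and let $1\le s_1<s_2<\dots<s_k$ be integers. For $n\ge 1$ let $C_n(s_1,\dots,s_k)$ be the circulant graph of even valency $2k$: its vertices are the residues modulo $n$, and for every vertex $i$ and every $j\in\{1,\dots,k\}$ there is one edge joining $i$ and $i+s_j \pmod n$ (for $n>2s_k$ this is a simple graph; for small $n$ loops and parallel edges may occur, and parallel edges are counted as different edges). Let $\tau(n)$ be the number of spanning trees of $C_n(s_1,\dots,s_k)$, which is $0$ if the graph is disconnected. Then the generating function $$F(x)=\sum_{n=1}^{\infty}\tau(n)\,x^n$$ is a rational function with integer coefficients: there are polynomials $P,Q\in\mathbb Z[x]$ with $Q(0)\ne 0$ such that $Q(x)F(x)=P(x)$ as formal power series. Moreover, $F(x)=F(1/x)$, that is, $P(1/x)/Q(1/x)=P(x)/Q(x)$ as rational functions. -/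

import Mathlib

open Polynomial

/-- A (multi)graph is a tree if it has neither loops nor parallel edges and is connected and acyclic,
i.e. the simple graph underlying it is a tree. -/
def Graph.IsTree {α β : Type*} (T : Graph α β) : Prop :=
  T.Simple ∧ T.toSimpleGraph.IsTree

/-- The number of spanning trees of a (multi)graph `G`, that is, of subgraphs of `G` which have
the same vertices as `G` and are trees. -/
noncomputable def Graph.numSpanningTrees {α β : Type*} (G : Graph α β) : ℕ :=
  {T : Graph α β | T.IsSpanningSubgraph G ∧ T.IsTree}.ncard

/-- The circulant graph `C_n(s_1, …, s_k)` of even valency `2k`: the vertices are the residues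
modulo `n`, and for every vertex `i` and every jump `s_j` there is one edge, labelled `(i, j)`,
between `i` and `i + s_j`. If `n > 2 s_k` this is a simple graph; for small `n` loops and
parallel edges occur. -/
def circulantMultigraph (n : ℕ) {k : ℕ} (s : Fin k → ℕ) : Graph (ZMod n) (ZMod n × Fin k) where
  vertexSet := Set.univ
  edgeSet := Set.univ
  IsLink e x y := (x = e.1 ∧ y = e.1 + s e.2) ∨ (y = e.1 ∧ x = e.1 + s e.2)
  isLink_symm _ _ := ⟨fun _ _ h => h.symm⟩
  eq_or_eq_of_isLink_of_isLink := by
    rintro e x y v w (⟨rfl, rfl⟩ | ⟨rfl, rfl⟩) (⟨rfl, rfl⟩ | ⟨rfl, rfl⟩) <;> simp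
  edge_mem_iff_exists_isLink e := by
    simp only [Set.mem_univ, true_iff]
    exact ⟨_, _, Or.inl ⟨rfl, rfl⟩⟩
  left_mem_of_isLink := fun _ _ _ _ => Set.mem_univ _

/-- The generating function `∑_{n ≥ 1} τ(n) xⁿ`, where `τ(n)` is the number of spanning trees of
`C_n(s_1, …, s_k)`. -/
noncomputable def spanningTreeSeries {k : ℕ} (s : Fin k → ℕ) : PowerSeries ℤ :=
  PowerSeries.mk fun n => if n = 0 then 0 else ((circulantMultigraph n s).numSpanningTrees : ℤ)

/-! With `L` the Laplacian and `J` the all-ones matrix, the matrix-tree theorem reads `det (L + J) =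
n² τ(n)`. The characters of `ZMod n` diagonalise `L + J`, so `n τ(n)` is the product of `∑ᵢ (2 -
w^sᵢ - w^(-sᵢ))` over the `n`-th roots of unity `w ≠ 1`
(`mul_numSpanningTrees_circulantMultigraph`). Each factor is `R(w + w⁻¹)` for a Chebyshev sum `R`,
whose root `2` is simple because `R'(2) = -∑ sᵢ² ≠ 0`. The root `2` contributes `± n²`, any other
root `t = z + z⁻¹` contributes `± (2 - zⁿ - z⁻ⁿ) / (2 - t)`. Hence `τ(n) = n f(n)` with `f` a
combination of sequences `μⁿ + μ⁻ⁿ` (`exists_evenExpSum_prod_stdAddChar`).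

The series of `n (μⁿ + μ⁻ⁿ)` is a quotient of polynomials palindromic for the same formal degree, a
property stable under linear combinations; the symmetry `x ↔ 1/x` follows. The quotient has complex
coefficients; a `ℤ`-linear functional makes them integral (`IsPalindromicRational.of_map`). -/

/-- A power series is palindromically rational if it is a quotient `P / Q` of two polynomials which
are both invariant under `A(x) ↦ x ^ d A(1/x)` for a common `d`. -/
def IsPalindromicRational {R : Type*} [CommRing R] (F : PowerSeries R) : Prop :=
  ∃ (d : ℕ) (P Q : R[X]), P.natDegree ≤ d ∧ Q.natDegree ≤ d ∧ P.reflect d = P ∧ Q.reflect d = Q ∧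
    Q.coeff 0 ≠ 0 ∧ (Q : PowerSeries R) * F = P

/-! ### Palindromic quotients: closure and descent to `ℤ` -/

namespace IsPalindromicRational

lemma zero {R : Type*} [CommRing R] [Nontrivial R] :
    IsPalindromicRational (0 : PowerSeries R) :=
  ⟨0, 0, 1, by simp, by simp, by simp, by simp [reflect_one], by simp, by simp⟩

lemma add {R : Type*} [CommRing R] [IsDomain R] {F G : PowerSeries R}
    (hF : IsPalindromicRational F) (hG : IsPalindromicRational G) :
    IsPalindromicRational (F + G) := by
  obtain ⟨d, P, Q, hP, hQ, rP, rQ, h0, h⟩ := hF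
  obtain ⟨d', P', Q', hP', hQ', rP', rQ', h0', h'⟩ := hG
  refine ⟨d + d', P * Q' + Q * P', Q * Q', ?_, ?_, ?_, ?_, ?_, ?_⟩
  · exact natDegree_add_le_of_degree_le (natDegree_mul_le_of_le hP hQ')
      (natDegree_mul_le_of_le hQ hP')
  · exact natDegree_mul_le_of_le hQ hQ'
  · rw [reflect_add, reflect_mul _ _ hP hQ', reflect_mul _ _ hQ hP', rP, rQ, rP', rQ']
  · rw [reflect_mul _ _ hQ hQ', rQ, rQ']
  · rw [mul_coeff_zero]
    exact mul_ne_zero h0 h0'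
  · push_cast
    rw [← h, ← h']
    ring

lemma smul {R : Type*} [CommRing R] {F : PowerSeries R} (hF : IsPalindromicRational F) (c : R) :
    IsPalindromicRational (c • F) := by
  obtain ⟨d, P, Q, hP, hQ, rP, rQ, h0, h⟩ := hF
  refine ⟨d, C c * P, Q, (natDegree_C_mul_le _ _).trans hP, hQ, ?_, rQ, h0, ?_⟩
  · rw [reflect_C_mul, rP]
  · rw [mul_smul_comm, h, coe_mul, coe_C, PowerSeries.smul_eq_C_mul]

/-- A power series with integer coefficients which is palindromically rational over an
extension of `ℤ` is palindromically rational over `ℤ`. -/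
lemma of_map {K : Type*} [Field K] [CharZero K] {F : PowerSeries ℤ}
    (hF : IsPalindromicRational (F.map (Int.castRingHom K))) : IsPalindromicRational F := by
  classical
  obtain ⟨d, P, Q, hP, hQ, rP, rQ, h0, h⟩ := hF
  set s : Finset K := (Finset.range (d + 1)).image P.coeff ∪ (Finset.range (d + 1)).image Q.coeff
    with hs
  set M : Submodule ℤ K := Submodule.span ℤ (s : Set K) with hM
  have hPM (i : ℕ) : P.coeff i ∈ M := by
    by_cases hi : i ≤ d
    · exact Submodule.subset_span (by simp only [hs, Finset.coe_union]; left; simpa using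
        ⟨i, by omega, rfl⟩)
    · rw [coeff_eq_zero_of_natDegree_lt (by omega)]
      exact M.zero_mem
  have hQM (i : ℕ) : Q.coeff i ∈ M := by
    by_cases hi : i ≤ d
    · exact Submodule.subset_span (by simp only [hs, Finset.coe_union]; right; simpa using
        ⟨i, by omega, rfl⟩)
    · rw [coeff_eq_zero_of_natDegree_lt (by omega)]
      exact M.zero_mem
  have : Module.Finite ℤ M := Module.Finite.span_finset ℤ s
  -- `M` is finitely generated and torsion-free, hence free, so functionals separate its points.
  -- Applying `φ` to coefficients preserves `Q * F = P`, since `F` is integral, and preserves the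
  -- palindromic symmetry.
  obtain ⟨φ, hφ⟩ : ∃ φ : Module.Dual ℤ M, φ ⟨Q.coeff 0, hQM 0⟩ ≠ 0 := by
    by_contra! hc
    have := (Module.forall_dual_apply_eq_zero_iff ℤ _).1 hc
    exact h0 (congrArg Subtype.val this)
  have key (A : K[X]) (hA : A.natDegree ≤ d) (hAM : ∀ i, A.coeff i ∈ M) :
      ∃ B : ℤ[X], ∀ i, B.coeff i = φ ⟨A.coeff i, hAM i⟩ := by
    refine ⟨∑ i ∈ Finset.range (d + 1), monomial i (φ ⟨A.coeff i, hAM i⟩), fun i ↦ ?_⟩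
    simp only [finsetSum_coeff, coeff_monomial, Finset.sum_ite_eq', Finset.mem_range]
    split_ifs with hi
    · rfl
    · have : (⟨A.coeff i, hAM i⟩ : M) = 0 :=
        Subtype.ext (coeff_eq_zero_of_natDegree_lt (by omega))
      rw [this, map_zero]
  obtain ⟨P', hP'⟩ := key P hP hPM
  obtain ⟨Q', hQ'⟩ := key Q hQ hQM
  have deg (A : K[X]) (hA : A.natDegree ≤ d) (hAM : ∀ i, A.coeff i ∈ M) (B : ℤ[X])
      (hB : ∀ i, B.coeff i = φ ⟨A.coeff i, hAM i⟩) : B.natDegree ≤ d := by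
    refine natDegree_le_iff_coeff_eq_zero.2 fun i hi ↦ ?_
    have : (⟨A.coeff i, hAM i⟩ : M) = 0 :=
      Subtype.ext (coeff_eq_zero_of_natDegree_lt (by omega))
    rw [hB, this, map_zero]
  have refl (A : K[X]) (hA : A.reflect d = A) (hAM : ∀ i, A.coeff i ∈ M) (B : ℤ[X])
      (hB : ∀ i, B.coeff i = φ ⟨A.coeff i, hAM i⟩) : B.reflect d = B := by
    ext i
    have : A.coeff (revAt d i) = A.coeff i := by rw [← coeff_reflect, hA]
    rw [coeff_reflect, hB, hB]
    simp only [this]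
  refine ⟨d, P', Q', deg P hP hPM _ hP', deg Q hQ hQM _ hQ', refl P rP hPM _ hP',
    refl Q rQ hQM _ hQ', by rwa [hQ'], ?_⟩
  ext m
  rw [coeff_coe, hP', PowerSeries.coeff_mul]
  have hm := congrArg (PowerSeries.coeff m) h
  rw [coeff_coe, PowerSeries.coeff_mul] at hm
  have : (⟨P.coeff m, hPM m⟩ : M) = ∑ p ∈ Finset.HasAntidiagonal.antidiagonal m,
      PowerSeries.coeff p.2 F • ⟨Q.coeff p.1, hQM p.1⟩ := by
    apply Subtype.ext
    simp only [AddSubmonoidClass.coe_finsetSum, Submodule.coe_smul, ← hm, coeff_coe,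
      PowerSeries.coeff_map, zsmul_eq_mul, eq_intCast, mul_comm]
  rw [this, map_sum]
  refine Finset.sum_congr rfl fun p _ ↦ ?_
  rw [map_smul, coeff_coe, hQ', smul_eq_mul, mul_comm]

end IsPalindromicRational

/-! ### Even exponential sums -/

/-- The space of the sequences which are linear combinations of the sequences `μ ^ n + μ ^ (-n)`. -/
noncomputable def evenExpSum (K : Type*) [Field K] : Submodule K (ℕ → K) :=
  Submodule.span K (Set.range fun (μ : Kˣ) (n : ℕ) ↦ (μ : K) ^ n + (μ⁻¹ : K) ^ n)

namespace evenExpSum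

variable {K : Type*} [Field K]

lemma pow_add_mem {μ : K} (hμ : μ ≠ 0) : (fun n : ℕ ↦ μ ^ n + μ⁻¹ ^ n) ∈ evenExpSum K :=
  Submodule.subset_span ⟨Units.mk0 μ hμ, by simp⟩

/-- On generators, the product for `μ` and `ν` is the sum of the generators for `μν` and `μν⁻¹`. -/
lemma mul_mem {f g : ℕ → K} (hf : f ∈ evenExpSum K) (hg : g ∈ evenExpSum K) :
    f * g ∈ evenExpSum K := by
  induction hf, hg using Submodule.span_induction₂ with
  | mem_mem x y hx hy =>
    obtain ⟨μ, rfl⟩ := hx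
    obtain ⟨ν, rfl⟩ := hy
    have := add_mem (pow_add_mem (mul_ne_zero μ.ne_zero ν.ne_zero))
      (pow_add_mem (mul_ne_zero μ.ne_zero (inv_ne_zero ν.ne_zero)))
    convert! this using 1
    ext n
    simp only [Pi.mul_apply, Pi.add_apply, mul_inv, inv_inv, mul_pow]
    ring
  | zero_left y hy => simp
  | zero_right x hx => simp
  | add_left x y z _ _ _ h₁ h₂ => rw [add_mul]; exact add_mem h₁ h₂
  | add_right x y z _ _ _ h₁ h₂ => rw [mul_add]; exact add_mem h₁ h₂
  | smul_left r x y _ _ h => rw [smul_mul_assoc]; exact Submodule.smul_mem _ _ h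
  | smul_right r x y _ _ h => rw [mul_smul_comm]; exact Submodule.smul_mem _ _ h

variable [CharZero K]

lemma const_mem (c : K) : (fun _ ↦ c) ∈ evenExpSum K := by
  convert! Submodule.smul_mem _ (c / 2) (pow_add_mem (one_ne_zero (α := K))) using 1
  ext n
  simp only [inv_one, one_pow, Pi.smul_apply, smul_eq_mul]
  ring

lemma neg_one_pow_mem : (fun n : ℕ ↦ (-1 : K) ^ n) ∈ evenExpSum K := by
  convert! Submodule.smul_mem _ (1 / 2) (pow_add_mem (neg_ne_zero.2 (one_ne_zero (α := K)))) using 1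
  ext n
  simp only [inv_neg, inv_one, Pi.smul_apply, smul_eq_mul]
  ring

end evenExpSum

/-! ### Generating functions of `n f(n)` -/

lemma one_sub_mul_X_sq_mul_mk {R : Type*} [CommRing R] (a : R) :
    (1 - PowerSeries.C a * PowerSeries.X) ^ 2 * PowerSeries.mk (fun n ↦ (n : R) * a ^ n) =
      PowerSeries.C a * PowerSeries.X := by
  have h₁ : (1 - PowerSeries.C a * PowerSeries.X) * PowerSeries.mk (fun n ↦ (n : R) * a ^ n) =
      PowerSeries.C a * PowerSeries.X * PowerSeries.mk (fun n ↦ a ^ n) := by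
    ext n
    rw [sub_mul, one_mul, mul_assoc, mul_assoc]
    cases n with
    | zero => simp
    | succ n =>
      simp only [map_sub, PowerSeries.coeff_C_mul, PowerSeries.coeff_succ_X_mul,
        PowerSeries.coeff_mk]
      push_cast
      ring
  have h₂ : (1 - PowerSeries.C a * PowerSeries.X) * PowerSeries.mk (fun n ↦ a ^ n) = 1 := by
    ext n
    rw [sub_mul, one_mul, mul_assoc]
    cases n with
    | zero => simp
    | succ n =>
      simp only [map_sub, PowerSeries.coeff_C_mul, PowerSeries.coeff_succ_X_mul,
        PowerSeries.coeff_mk, PowerSeries.coeff_one]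
      simp [pow_succ']
  rw [sq, mul_assoc, h₁, mul_left_comm, h₂, mul_one]

lemma reflect_one_sub_mul_X_add_X_sq {R : Type*} [CommRing R] (t : R) :
    (1 - C t * X + X ^ 2 : R[X]).reflect 2 = 1 - C t * X + X ^ 2 := by
  have h₁ := reflect_monomial (R := R) 2 0
  have h₂ := reflect_monomial (R := R) 2 2
  have h₃ := reflect_C_mul_X_pow 2 1 (c := t)
  simp only [revAt_le (show 0 ≤ 2 by omega), revAt_le (show 1 ≤ 2 by omega), revAt_le le_rfl, pow_zero,
    Nat.sub_zero, Nat.sub_self, pow_one, Nat.reduceSub] at h₁ h₂ h₃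
  rw [reflect_add, reflect_sub, h₂, h₃, h₁]
  ring

lemma natDegree_one_sub_mul_X_add_X_sq_le {R : Type*} [CommRing R] (t : R) :
    (1 - C t * X + X ^ 2 : R[X]).natDegree ≤ 2 := by
  compute_degree

/-- If `f` is a combination of the sequences `μ ^ n + μ ^ (-n)`, then the generating function of
`n f(n)` is palindromically rational. -/
lemma isPalindromicRational_mk_mul {K : Type*} [Field K] {f : ℕ → K} (hf : f ∈ evenExpSum K) :
    IsPalindromicRational (PowerSeries.mk fun n ↦ n * f n) := by
  induction hf using Submodule.span_induction with
  | mem x hx =>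
    obtain ⟨μ, rfl⟩ := hx
    have hμ : (μ : K) * (μ⁻¹ : K) = 1 := mul_inv_cancel₀ μ.ne_zero
    beta_reduce
    generalize (μ⁻¹ : K) = b at *
    generalize (μ : K) = a at *
    have hd := natDegree_one_sub_mul_X_add_X_sq_le (a + b)
    -- This is `aX/(1 - aX)² + bX/(1 - bX)²` over a common denominator, simplified by `ab = 1`.
    refine ⟨2 + 2, X * (C (a + b) * (1 + X ^ 2) - 4 * X), (1 - C (a + b) * X + X ^ 2) ^ 2, ?_, ?_,
      ?_, ?_, ?_, ?_⟩
    · compute_degree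
      omega
    · rw [sq]
      exact natDegree_mul_le_of_le hd hd
    · have h₁ := reflect_C_mul_X_pow 4 1 (c := a + b)
      have h₂ := reflect_C_mul_X_pow 4 2 (c := (4 : K))
      have h₃ := reflect_C_mul_X_pow 4 3 (c := a + b)
      simp only [revAt_le (show 1 ≤ 4 by omega), revAt_le (show 2 ≤ 4 by omega),
        revAt_le (show 3 ≤ 4 by omega), Nat.reduceSub] at h₁ h₂ h₃
      have : (X * (C (a + b) * (1 + X ^ 2) - 4 * X) : K[X]) =
          C (a + b) * X ^ 1 - C 4 * X ^ 2 + C (a + b) * X ^ 3 := by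
        rw [show (C 4 : K[X]) = 4 from rfl]
        ring
      rw [this, show 2 + 2 = 4 from rfl, reflect_add, reflect_sub, h₁, h₂, h₃]
      ring
    · rw [sq, reflect_mul _ _ hd hd, reflect_one_sub_mul_X_add_X_sq]
    · simp [coeff_zero_eq_eval_zero]
    · have e : PowerSeries.mk (fun n : ℕ ↦ (n : K) * (a ^ n + b ^ n)) =
          PowerSeries.mk (fun n : ℕ ↦ (n : K) * a ^ n) +
            PowerSeries.mk (fun n : ℕ ↦ (n : K) * b ^ n) := by
        ext n
        simp [mul_add]
      have ha := one_sub_mul_X_sq_mul_mk a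
      have hb := one_sub_mul_X_sq_mul_mk b
      have hab : (PowerSeries.C a : PowerSeries K) * PowerSeries.C b = 1 := by
        rw [← map_mul, hμ, map_one]
      rw [e]
      push_cast
      rw [show ((4 : K[X]) : PowerSeries K) = 4 from
        map_ofNat (coeToPowerSeries.ringHom (R := K)) 4]
      rw [map_add]
      have hq : (1 - (PowerSeries.C a + PowerSeries.C b) * PowerSeries.X + PowerSeries.X ^ 2 :
          PowerSeries K) = (1 - PowerSeries.C a * PowerSeries.X) *
            (1 - PowerSeries.C b * PowerSeries.X) := by
        linear_combination (-PowerSeries.X ^ 2) * hab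
      rw [hq]
      linear_combination (1 - PowerSeries.C b * PowerSeries.X) ^ 2 * ha +
        (1 - PowerSeries.C a * PowerSeries.X) ^ 2 * hb +
        (-4 * PowerSeries.X ^ 2 + (PowerSeries.C a + PowerSeries.C b) * PowerSeries.X ^ 3) * hab
  | zero =>
    convert! IsPalindromicRational.zero (R := K)
    ext n
    simp
  | add x y _ _ hx hy =>
    convert! hx.add hy using 1
    ext n
    simp [mul_add]
  | smul c x _ hx =>
    convert! hx.smul c using 1
    ext n
    simp [mul_left_comm]

/-- `A(x) = x^d A(1/x)` holds for numerator and denominator with the same `d`, so `x^d` cancels. -/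
lemma IsPalindromicRational.exists_aeval_inv_eq {F : PowerSeries ℤ} (hF : IsPalindromicRational F) :
    ∃ P Q : ℤ[X], Q.coeff 0 ≠ 0 ∧ (Q : PowerSeries ℤ) * F = (P : PowerSeries ℤ) ∧
      aeval (RatFunc.X⁻¹ : RatFunc ℚ) P / aeval (RatFunc.X⁻¹ : RatFunc ℚ) Q =
        aeval (RatFunc.X : RatFunc ℚ) P / aeval (RatFunc.X : RatFunc ℚ) Q := by
  obtain ⟨d, P, Q, hP, hQ, rP, rQ, h0, h⟩ := hF
  refine ⟨P, Q, h0, h, ?_⟩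
  have hX : (RatFunc.X : RatFunc ℚ) ≠ 0 := RatFunc.X_ne_zero
  let _ := invertibleOfNonzero hX
  have key (A : ℤ[X]) (hA : A.natDegree ≤ d) (rA : A.reflect d = A) :
      aeval (RatFunc.X : RatFunc ℚ) A = aeval (RatFunc.X⁻¹ : RatFunc ℚ) A * RatFunc.X ^ d := by
    have := eval₂_reflect_mul_pow (algebraMap ℤ (RatFunc ℚ)) RatFunc.X d A hA
    rw [rA, invOf_eq_inv] at this
    rw [aeval_def, aeval_def, this]
  rw [key P hP rP, key Q hQ rQ, mul_div_mul_right _ _ (pow_ne_zero _ hX)]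

/-! ### Chebyshev polynomials with `C_n(x + x⁻¹) = xⁿ + x⁻ⁿ` -/

section Chebyshev

variable (R : Type*) [CommRing R]

lemma natDegree_chebyshev_C_le (n : ℕ) : (Chebyshev.C R n).natDegree ≤ n := by
  induction n using Nat.twoStepInduction with
  | zero => simp
  | one => simp [natDegree_X_le]
  | more n h₀ h₁ =>
    push_cast at h₁ ⊢
    rw [Chebyshev.C_add_two]
    refine (natDegree_sub_le _ _).trans (max_le ?_ (h₀.trans (by omega)))
    exact natDegree_mul_le.trans (by have := natDegree_X_le (R := R); omega)

lemma coeff_chebyshev_C_self (n : ℕ) (hn : n ≠ 0) : (Chebyshev.C R n).coeff n = 1 := by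
  obtain ⟨n, rfl⟩ := Nat.exists_eq_succ_of_ne_zero hn
  clear hn
  induction n with
  | zero => simp
  | succ n h =>
    have h₀ := natDegree_chebyshev_C_le R n
    push_cast at h ⊢
    rw [add_assoc, one_add_one_eq_two, Chebyshev.C_add_two, coeff_sub, coeff_X_mul, h,
      coeff_eq_zero_of_natDegree_lt (by omega), sub_zero]

/-- Since `C_n(2) = 2`, the recurrence gives `d(n+2) = 2 + 2 d(n+1) - d(n)` for the derivatives at
`2`. This serves to show that a root at `2` is simple. -/
lemma derivative_chebyshev_C_eval_two (n : ℕ) :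
    (derivative (Chebyshev.C R n)).eval 2 = (n : R) ^ 2 := by
  induction n using Nat.twoStepInduction with
  | zero => simp
  | one => simp
  | more n h₀ h₁ =>
    push_cast at h₁ ⊢
    rw [Chebyshev.C_add_two, derivative_sub, derivative_mul, eval_sub, eval_add, eval_mul,
      eval_mul, h₀, h₁, Chebyshev.C_eval_two]
    simp only [derivative_X, eval_one, eval_X]
    ring

lemma chebyshev_C_eval_add_inv {K : Type*} [Field K] {x : K} (hx : x ≠ 0) (n : ℕ) :
    (Chebyshev.C K n).eval (x + x⁻¹) = x ^ n + x⁻¹ ^ n := by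
  rw [← dickson_one_one_eq_chebyshev_C, dickson_one_one_eval_add_inv _ _ (mul_inv_cancel₀ hx)]

end Chebyshev

lemma neg_one_pow_pred {R : Type*} [Ring R] (n : ℕ) (hn : n ≠ 0) : (-1 : R) ^ (n - 1) = -(-1) ^ n := by
  obtain ⟨m, rfl⟩ := Nat.exists_eq_succ_of_ne_zero hn
  simp [pow_succ]

/-! ### Products over nontrivial roots of unity -/

section RootsOfUnity

variable (n : ℕ) [NeZero n]

lemma X_pow_sub_one_eq_prod_stdAddChar :
    (X ^ n - 1 : ℂ[X]) = ∏ j : ZMod n, (X - C (ZMod.stdAddChar j)) := by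
  classical
  have hinj := ZMod.injective_stdAddChar (N := n)
  have h := Complex.isPrimitiveRoot_exp n (NeZero.ne n)
  rw [X_pow_sub_one_eq_prod (NeZero.pos n) h,
    ← Finset.prod_image (s := Finset.univ) (f := fun x : ℂ ↦ X - C x) hinj.injOn]
  congr 1
  refine (Finset.eq_of_subset_of_card_le (fun x hx ↦ ?_) ?_).symm
  · obtain ⟨j, -, rfl⟩ := Finset.mem_image.1 hx
    rw [mem_nthRootsFinset (NeZero.pos n), ← AddChar.map_nsmul_eq_pow]
    simp
  · rw [h.card_nthRootsFinset, Finset.card_image_of_injective _ hinj, Finset.card_univ, ZMod.card]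

lemma prod_sub_stdAddChar (z : ℂ) :
    ∏ j ∈ Finset.univ.erase (0 : ZMod n), (z - ZMod.stdAddChar j) =
      ∑ i ∈ Finset.range n, z ^ i := by
  have h : ∏ j ∈ Finset.univ.erase (0 : ZMod n), (X - C (ZMod.stdAddChar j)) =
      ∑ i ∈ Finset.range n, (X : ℂ[X]) ^ i := by
    refine mul_left_cancel₀ (X_sub_C_ne_zero (1 : ℂ)) ?_
    have := Finset.mul_prod_erase Finset.univ (fun j : ZMod n ↦ (X - C (ZMod.stdAddChar j) : ℂ[X]))
      (Finset.mem_univ 0)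
    rw [AddChar.map_zero_eq_one] at this
    rw [this, ← X_pow_sub_one_eq_prod_stdAddChar, map_one, mul_geom_sum]
  simpa [eval_prod, eval_finsetSum] using congrArg (eval z) h

/-- Each factor is `(z - w)(z⁻¹ - w) / w`, so evaluating `(Xⁿ - 1)/(X - 1)` at `z`, `z⁻¹` and `0`
gives the product. -/
lemma prod_stdAddChar_add_inv_sub {z : ℂ} (hz : z ≠ 0) :
    ∏ j ∈ Finset.univ.erase (0 : ZMod n),
        (ZMod.stdAddChar j + (ZMod.stdAddChar j)⁻¹ - (z + z⁻¹)) =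
      (-1) ^ (n - 1) * ((∑ i ∈ Finset.range n, z ^ i) * ∑ i ∈ Finset.range n, z⁻¹ ^ i) := by
  have h₀ : ∏ j ∈ Finset.univ.erase (0 : ZMod n), (0 - ZMod.stdAddChar j : ℂ) = 1 := by
    rw [prod_sub_stdAddChar, Finset.sum_eq_single_of_mem 0 (by simp [NeZero.pos n])]
    · simp
    · intro i _ hi
      simp [hi]
  have hc : (Finset.univ.erase (0 : ZMod n)).card = n - 1 := by
    rw [Finset.card_erase_of_mem (Finset.mem_univ _), Finset.card_univ, ZMod.card]
  have (j : ZMod n) : (ZMod.stdAddChar j + (ZMod.stdAddChar j)⁻¹ - (z + z⁻¹) : ℂ) =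
      (-1) * ((z - ZMod.stdAddChar j) * (z⁻¹ - ZMod.stdAddChar j) / (0 - ZMod.stdAddChar j)) := by
    have hj : (ZMod.stdAddChar j : ℂ) ≠ 0 := (ZMod.stdAddChar (N := n)).val_isUnit j |>.ne_zero
    rw [zero_sub, div_neg, neg_one_mul, neg_neg]
    field_simp
    ring
  rw [Finset.prod_congr rfl fun j _ ↦ this j, Finset.prod_mul_distrib, Finset.prod_const, hc,
    Finset.prod_div_distrib, Finset.prod_mul_distrib, h₀, div_one, prod_sub_stdAddChar,
    prod_sub_stdAddChar]

lemma prod_stdAddChar_add_inv_sub_two :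
    ∏ j ∈ Finset.univ.erase (0 : ZMod n),
        (ZMod.stdAddChar j + (ZMod.stdAddChar j)⁻¹ - 2 : ℂ) = -(-1) ^ n * (n : ℂ) ^ 2 := by
  have := prod_stdAddChar_add_inv_sub n (one_ne_zero (α := ℂ))
  rw [inv_one, one_add_one_eq_two] at this
  rw [this, neg_one_pow_pred n (NeZero.ne n)]
  simp [sq]

end RootsOfUnity

lemma exists_ne_zero_add_inv_eq {K : Type*} [Field K] [IsAlgClosed K] (t : K) :
    ∃ z : K, z ≠ 0 ∧ z + z⁻¹ = t := by
  have hd : (X ^ 2 - C t * X + 1 : K[X]).degree = 2 := by compute_degree!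
  obtain ⟨z, hz⟩ := IsAlgClosed.exists_root (X ^ 2 - C t * X + 1 : K[X]) (by rw [hd]; decide)
  simp only [IsRoot.def, eval_add, eval_sub, eval_pow, eval_X, eval_mul, eval_C, eval_one] at hz
  have h0 : z ≠ 0 := by
    rintro rfl
    simp at hz
  refine ⟨z, h0, ?_⟩
  field_simp
  linear_combination hz

/-- With `t = z + z⁻¹`, the condition `t ≠ 2` means `z ≠ 1`, so both geometric sums have closed
forms; their product is `(2 - zⁿ - z⁻ⁿ) / (2 - t)`. -/
lemma exists_evenExpSum_prod_sub {t : ℂ} (ht : t ≠ 2) :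
    ∃ f ∈ evenExpSum ℂ, ∀ (n : ℕ) [NeZero n],
      ∏ j ∈ Finset.univ.erase (0 : ZMod n),
        (ZMod.stdAddChar j + (ZMod.stdAddChar j)⁻¹ - t) = f n := by
  obtain ⟨z, hz, rfl⟩ := exists_ne_zero_add_inv_eq t
  refine ⟨-((fun n ↦ (-1) ^ n) * ((2 - (z + z⁻¹))⁻¹ •
    ((fun _ ↦ 2) - fun n ↦ z ^ n + z⁻¹ ^ n))), ?_, fun n _ ↦ ?_⟩
  · exact neg_mem (evenExpSum.mul_mem evenExpSum.neg_one_pow_mem (Submodule.smul_mem _ _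
      (sub_mem (evenExpSum.const_mem _) (evenExpSum.pow_add_mem hz))))
  · have h1 : z ≠ 1 := by
      rintro rfl
      norm_num at ht
    have h1' : z⁻¹ ≠ 1 := by simpa using h1
    rw [prod_stdAddChar_add_inv_sub n hz, neg_one_pow_pred n (NeZero.ne n), geom_sum_eq h1,
      geom_sum_eq h1', div_mul_div_comm]
    have h2 : (z - 1) * (z⁻¹ - 1) = 2 - (z + z⁻¹) := by
      field_simp
      ring
    have h3 : (z ^ n - 1) * (z⁻¹ ^ n - 1) = 2 - (z ^ n + z⁻¹ ^ n) := by
      have : z ^ n * z⁻¹ ^ n = 1 := by rw [← mul_pow, mul_inv_cancel₀ hz, one_pow]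
      linear_combination this
    rw [h2, h3]
    simp only [Pi.neg_apply, Pi.mul_apply, Pi.smul_apply, Pi.sub_apply, smul_eq_mul]
    rw [div_eq_inv_mul]
    ring

lemma exists_evenExpSum_prod_multiset (m : Multiset ℂ) (hm : (2 : ℂ) ∉ m) :
    ∃ f ∈ evenExpSum ℂ, ∀ (n : ℕ) [NeZero n],
      ∏ j ∈ Finset.univ.erase (0 : ZMod n),
        (m.map fun t ↦ (ZMod.stdAddChar j + (ZMod.stdAddChar j)⁻¹ - t)).prod = f n := by
  induction m using Multiset.induction_on with
  | empty => exact ⟨_, evenExpSum.const_mem 1, by simp⟩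
  | cons t m ih =>
    obtain ⟨f, hf, h⟩ := ih fun h ↦ hm (Multiset.mem_cons_of_mem h)
    obtain ⟨g, hg, h'⟩ := exists_evenExpSum_prod_sub (t := t)
      fun h ↦ hm (h ▸ Multiset.mem_cons_self _ _)
    refine ⟨g * f, evenExpSum.mul_mem hg hf, fun n _ ↦ ?_⟩
    simp only [Multiset.map_cons, Multiset.prod_cons, Finset.prod_mul_distrib, Pi.mul_apply, h, h']

/-- The nontrivial values of `∑ i, (2 - w ^ s i - w ^ (-s i))` at the `n`-th roots of unity `w` have
a product of the form `n ^ 2 * f n`, where `f` is a combination of sequences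
`μ ^ n + μ ^ (-n)`. -/
theorem exists_evenExpSum_prod_stdAddChar {k : ℕ} (hk : 1 ≤ k) {s : Fin k → ℕ}
    (hpos : ∀ i, 1 ≤ s i) (hs : StrictMono s) :
    ∃ f ∈ evenExpSum ℂ, ∀ (n : ℕ) [NeZero n],
      ∏ j ∈ Finset.univ.erase (0 : ZMod n), ∑ i, (2 - (ZMod.stdAddChar j ^ s i +
        (ZMod.stdAddChar j)⁻¹ ^ s i) : ℂ) = (n : ℂ) ^ 2 * f n := by
  classical
  set R : ℂ[X] := ∑ i, (2 - Chebyshev.C ℂ (s i)) with hR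
  set l : Fin k := ⟨k - 1, by omega⟩ with hl
  have hCle (i : Fin k) : (2 - Chebyshev.C ℂ (s i)).natDegree ≤ s i :=
    (natDegree_sub_le _ _).trans (max_le (by simp) (natDegree_chebyshev_C_le ℂ _))
  have hle (i : Fin k) : i ≤ l := by
    rw [Fin.le_def, hl]
    have := i.isLt
    simp only
    omega
  have hdeg : R.natDegree ≤ s l :=
    natDegree_sum_le_of_forall_le _ _ fun i _ ↦ (hCle i).trans (hs.monotone (hle i))
  have hl0 : s l ≠ 0 := by have := hpos l; omega
  have h2 : (2 : ℂ[X]).coeff (s l) = 0 := by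
    rw [show (2 : ℂ[X]) = C 2 from rfl, coeff_C_of_ne_zero hl0]
  have hcoeff : R.coeff (s l) = -1 := by
    -- The jumps are distinct, so only the largest reaches the top degree.
    rw [hR, finsetSum_coeff, Finset.sum_eq_single_of_mem l (Finset.mem_univ _)]
    · rw [coeff_sub, coeff_chebyshev_C_self _ _ hl0, h2, zero_sub]
    · intro i _ hi
      exact coeff_eq_zero_of_natDegree_lt ((hCle i).trans_lt (hs (lt_of_le_of_ne (hle i) hi)))
  have hlead : R.leadingCoeff = -1 := by
    rw [leadingCoeff, natDegree_eq_of_le_of_coeff_ne_zero hdeg (by rw [hcoeff]; norm_num), hcoeff]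
  have hroot : R.IsRoot 2 := by simp [R, eval_finsetSum]
  obtain ⟨T, hT⟩ := dvd_iff_isRoot.2 hroot
  have hTlead : T.leadingCoeff = -1 := by
    rw [hT, leadingCoeff_mul, leadingCoeff_X_sub_C, one_mul] at hlead
    exact hlead
  have hT0 : T ≠ 0 := by
    rintro rfl
    simp at hTlead
  -- `T(2) = R'(2) = -∑ sᵢ²`, so `2` is a simple root of `R`.
  have hT2 : T.eval 2 ≠ 0 := by
    have h : (derivative R).eval 2 = T.eval 2 := by
      rw [hT, derivative_mul]
      simp
    rw [← h, hR, derivative_sum, eval_finsetSum]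
    have (i : Fin k) : (derivative (2 - Chebyshev.C ℂ (s i))).eval 2 = -((s i ^ 2 : ℕ) : ℂ) := by
      rw [derivative_sub, eval_sub, derivative_chebyshev_C_eval_two]
      simp
    rw [Finset.sum_congr rfl fun i _ ↦ this i, Finset.sum_neg_distrib, ← Nat.cast_sum, neg_ne_zero,
      Nat.cast_ne_zero]
    have := Finset.single_le_sum (f := fun i ↦ s i ^ 2) (fun _ _ ↦ Nat.zero_le _)
      (Finset.mem_univ l)
    have h0 : 0 < s l ^ 2 := by positivity
    omega
  have hTev (x : ℂ) : T.eval x = -(T.roots.map fun t ↦ x - t).prod := by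
    conv_lhs => rw [(IsAlgClosed.splits T).eq_prod_roots, hTlead]
    rw [eval_mul, eval_C, eval_multiset_prod, Multiset.map_map]
    simp
  have hRev (x : ℂ) : R.eval x = -((x - 2) * (T.roots.map fun t ↦ x - t).prod) := by
    rw [hT, eval_mul, hTev]
    simp
  obtain ⟨f, hf, h⟩ := exists_evenExpSum_prod_multiset T.roots
    fun h ↦ hT2 (by simpa using (mem_roots'.1 h).2)
  refine ⟨f, hf, fun n _ ↦ ?_⟩
  have hlam (j : ZMod n) : ∑ i, (2 - (ZMod.stdAddChar j ^ s i +
      (ZMod.stdAddChar j)⁻¹ ^ s i) : ℂ) = R.eval (ZMod.stdAddChar j + (ZMod.stdAddChar j)⁻¹) := by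
    have hj : (ZMod.stdAddChar j : ℂ) ≠ 0 := (ZMod.stdAddChar (N := n)).val_isUnit j |>.ne_zero
    rw [hR, eval_finsetSum]
    refine Finset.sum_congr rfl fun i _ ↦ ?_
    rw [eval_sub, chebyshev_C_eval_add_inv hj]
    simp
  have hc : (Finset.univ.erase (0 : ZMod n)).card = n - 1 := by
    rw [Finset.card_erase_of_mem (Finset.mem_univ _), Finset.card_univ, ZMod.card]
  rw [Finset.prod_congr rfl fun j _ ↦ (hlam j).trans (hRev _), Finset.prod_neg,
    Finset.prod_mul_distrib, h, prod_stdAddChar_add_inv_sub_two, hc,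
    neg_one_pow_pred n (NeZero.ne n)]
  have : ((-1 : ℂ) ^ n) * (-1) ^ n = 1 := by rw [← mul_pow]; simp
  linear_combination (n : ℂ) ^ 2 * f n * this

/-! ### Cauchy–Binet -/

namespace Matrix

variable {V κ R : Type*} [Fintype V] [DecidableEq V] [Fintype κ] [CommRing R]

lemma det_transpose_mul_eq_sum (A B : Matrix κ V R) :
    (Aᵀ * B).det = ∑ f : V → κ, (∏ v, A (f v) v) * (B.submatrix f id).det := by
  have h : (Aᵀ * B) = fun v ↦ ∑ k, A k v • B k := by
    ext v w
    simp [Matrix.mul_apply, Finset.sum_apply]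
  have := (detRowAlternating (n := V) (R := R)).toMultilinearMap.map_sum
    (fun v k ↦ A k v • B k)
  rw [h]
  refine this.trans (Finset.sum_congr rfl fun f _ ↦ ?_)
  exact (MultilinearMap.map_smul_univ _ (fun v ↦ A (f v) v) (fun v ↦ B (f v))).trans rfl

/-- The **Cauchy–Binet formula**, in the form of a sum over all families of rows. -/
theorem factorial_mul_det_transpose_mul (A B : Matrix κ V R) :
    ((Fintype.card V).factorial : R) * (Aᵀ * B).det =
      ∑ f : V → κ, (A.submatrix f id).det * (B.submatrix f id).det := by
  -- Reindexing `f` by `σ` permutes the rows of `B`, at the cost of a sign. Summing over all `σ`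
  -- then assembles the determinant of `A`.
  have h (σ : Equiv.Perm V) : (Aᵀ * B).det = ∑ f : V → κ,
      ((Equiv.Perm.sign σ : ℤ) : R) * (∏ v, A (f (σ v)) v) * (B.submatrix f id).det := by
    rw [det_transpose_mul_eq_sum, ← (Equiv.arrowCongr σ (Equiv.refl κ)).sum_comp
      (fun f : V → κ ↦ ((Equiv.Perm.sign σ : ℤ) : R) * (∏ v, A (f (σ v)) v) *
        (B.submatrix f id).det)]
    refine Finset.sum_congr rfl fun f _ ↦ ?_
    have e : B.submatrix ((Equiv.arrowCongr σ (Equiv.refl κ)) f) id =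
        (B.submatrix f id).submatrix σ.symm id := by
      ext i j
      simp [Equiv.arrowCongr]
    rw [e, det_permute]
    have hs : (((Equiv.Perm.sign σ : ℤ) : R)) * ((Equiv.Perm.sign σ.symm : ℤ) : R) = 1 := by
      rw [Equiv.Perm.sign_symm, ← Int.cast_mul, ← Units.val_mul, Int.units_mul_self]
      simp
    simp only [Equiv.arrowCongr_apply, Equiv.coe_refl, Function.comp_apply, id,
      Equiv.symm_apply_apply]
    linear_combination (-(∏ v, A (f v) v) * (B.submatrix f id).det) * hs
  have h' : ((Fintype.card V).factorial : R) * (Aᵀ * B).det =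
      ∑ σ : Equiv.Perm V, (Aᵀ * B).det := by
    rw [Finset.sum_const, Finset.card_univ, Fintype.card_perm, nsmul_eq_mul]
  rw [h', Finset.sum_congr rfl fun σ _ ↦ h σ, Finset.sum_comm]
  refine Finset.sum_congr rfl fun f _ ↦ ?_
  rw [← Finset.sum_mul, det_apply' (A.submatrix f id)]
  rfl

end Matrix

/-! ### The matrix-tree theorem -/

section MatrixTree

variable {V E : Type*}

/-- The graph on `V` whose edges are the (nonloop) pairs `{src e, tgt e}` for `e ∈ S`. -/
def edgeGraph (src tgt : E → V) (S : Finset E) : SimpleGraph V :=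
  SimpleGraph.fromRel fun x y ↦ ∃ e ∈ S, src e = x ∧ tgt e = y

/-- A property which is compatible with all the edges of a connected graph holds for all vertices
as soon as it holds for one. -/
lemma edgeGraph_connected_induction {src tgt : E → V} {S : Finset E}
    (hc : (edgeGraph src tgt S).Connected) {p : V → Prop}
    (hp : ∀ e ∈ S, p (src e) ↔ p (tgt e)) {x : V} (h0 : p x) (y : V) : p y := by
  obtain ⟨w⟩ := hc.preconnected x y
  induction w with
  | nil => exact h0
  | cons hadj w ih =>
    refine ih ?_
    rw [edgeGraph, SimpleGraph.fromRel_adj] at hadj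
    obtain ⟨-, ⟨e, he, rfl, rfl⟩ | ⟨e, he, rfl, rfl⟩⟩ := hadj
    · exact (hp e he).1 h0
    · exact (hp e he).2 h0

variable [Fintype V] [DecidableEq V]

/-- The transpose of the oriented incidence matrix, with an additional row of ones. -/
def augmentedIncidence (R : Type*) [CommRing R] (src tgt : E → V) : Matrix (Option E) V R
  | none => 1
  | some e => Pi.single (src e) 1 - Pi.single (tgt e) 1

variable {src tgt : E → V} {f : V → Option E}

lemma augmentedIncidence_some_dotProduct {R : Type*} [CommRing R] (e : E) (u : V → R) :
    augmentedIncidence R src tgt (some e) ⬝ᵥ u = u (src e) - u (tgt e) := by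
  simp [augmentedIncidence, sub_dotProduct]

lemma augmentedIncidence_none_dotProduct {R : Type*} [CommRing R] (u : V → R) :
    augmentedIncidence R src tgt none ⬝ᵥ u = ∑ v, u v := by
  simp [augmentedIncidence, dotProduct]

open Matrix in
lemma injective_of_det_augmentedIncidence_ne_zero
    (h : ((augmentedIncidence ℤ src tgt).submatrix f id).det ≠ 0) : Function.Injective f := by
  intro v w hvw
  by_contra hne
  refine h (det_zero_of_row_eq hne ?_)
  ext x
  simp [hvw]

open Matrix in
-- Every edge row annihilates the all-ones vector.
lemma exists_eq_none_of_det_augmentedIncidence_ne_zero [Nonempty V]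
    (h : ((augmentedIncidence ℤ src tgt).submatrix f id).det ≠ 0) : ∃ v, f v = none := by
  by_contra! hf
  refine h (exists_mulVec_eq_zero_iff.1 ⟨1, one_ne_zero, ?_⟩)
  ext v
  obtain ⟨e, he⟩ := Option.ne_none_iff_exists'.1 (hf v)
  have := augmentedIncidence_some_dotProduct (src := src) (tgt := tgt) e (1 : V → ℤ)
  simpa [mulVec, ← he] using this

open Matrix in
lemma connected_of_det_augmentedIncidence_ne_zero [Nonempty V] {S : Finset E}
    (hS : ∀ v e, f v = some e → e ∈ S)
    (h : ((augmentedIncidence ℤ src tgt).submatrix f id).det ≠ 0) :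
    (edgeGraph src tgt S).Connected := by
  classical
  by_contra hc
  obtain ⟨r, y, hry⟩ : ∃ r y, ¬ (edgeGraph src tgt S).Reachable r y := by
    by_contra! hcon
    exact hc ⟨hcon⟩
  set c : Finset V := Finset.univ.filter fun x ↦ (edgeGraph src tgt S).Reachable r x with hcdef
  have hlt : c.card < Fintype.card V := by
    refine Finset.card_lt_univ_of_notMem (x := y) ?_
    simpa [hcdef] using hry
  -- For a component `c` with `c ≠ V`, this `u` is constant along edges and sums to zero, so every
  -- row annihilates it; at `r` it equals `|V| - |c| ≠ 0`.
  set u : V → ℤ := fun x ↦ (if x ∈ c then (Fintype.card V : ℤ) else 0) - c.card with hu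
  refine h (exists_mulVec_eq_zero_iff.1 ⟨u, fun h0 ↦ ?_, ?_⟩)
  · have h1 := congrFun h0 r
    have hr : r ∈ c := by simp [hcdef]
    simp only [hu, hr, if_true, Pi.zero_apply] at h1
    omega
  · ext v
    change augmentedIncidence ℤ src tgt (f v) ⬝ᵥ u = 0
    cases hv : f v with
    | none =>
      rw [augmentedIncidence_none_dotProduct]
      simp [hu, Finset.sum_sub_distrib, mul_comm]
    | some e =>
      rw [augmentedIncidence_some_dotProduct]
      have : src e ∈ c ↔ tgt e ∈ c := by
        by_cases hst : src e = tgt e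
        · rw [hst]
        have hadj : (edgeGraph src tgt S).Adj (src e) (tgt e) := by
          rw [edgeGraph, SimpleGraph.fromRel_adj]
          exact ⟨hst, Or.inl ⟨e, hS v e hv, rfl, rfl⟩⟩
        simp only [hcdef, Finset.mem_filter, Finset.mem_univ, true_and]
        exact ⟨fun h ↦ h.trans hadj.reachable, fun h ↦ h.trans hadj.symm.reachable⟩
      simp [hu, this]

open Matrix in
-- Modulo the edge rows all unit vectors agree, by connectedness. So replacing the row of ones by
-- one unit vector divides the determinant by `|V|`, and the rows of the new matrix span `ℤ^V`,
-- which forces its determinant to be `±1`.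
lemma det_augmentedIncidence_sq_of_connected [Nonempty V] {S : Finset E}
    (hS : ∀ e ∈ S, ∃ v, f v = some e) {r : V} (hr : f r = none)
    (hc : (edgeGraph src tgt S).Connected) :
    ((augmentedIncidence ℤ src tgt).submatrix f id).det ^ 2 = (Fintype.card V : ℤ) ^ 2 := by
  set A := (augmentedIncidence ℤ src tgt).submatrix f id with hA
  have hrow {v : V} {e : E} (hv : f v = some e) :
      A v = Pi.single (src e) 1 - Pi.single (tgt e) 1 := by
    ext x
    simp [hA, hv, augmentedIncidence]
  have hrr : A r = ∑ x, Pi.single x 1 := by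
    ext x
    simp [hA, hr, augmentedIncidence, Finset.sum_apply, Pi.single_apply]
  have hconn := fun p hp h0 ↦ edgeGraph_connected_induction hc (p := p) hp (x := r) h0
  have hD (x : V) : (A.updateRow r (Pi.single x 1)).det = (A.updateRow r (Pi.single r 1)).det := by
    refine hconn (fun x ↦ (A.updateRow r (Pi.single x 1)).det =
      (A.updateRow r (Pi.single r 1)).det) (fun e he ↦ ?_) rfl x
    obtain ⟨v, hv⟩ := hS e he
    have hvr : v ≠ r := by
      rintro rfl
      simp [hr] at hv
    have h0 : (A.updateRow r (A v)).det = 0 := det_updateRow_eq_zero hvr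
    have h1 : Pi.single (src e) 1 = A v + Pi.single (tgt e) 1 := by
      rw [hrow hv]
      abel
    rw [h1, det_updateRow_add, h0, zero_add]
  have hdet : A.det = Fintype.card V * (A.updateRow r (Pi.single r 1)).det := by
    have h1 : A.det = (A.updateRow r (∑ x, Pi.single x 1)).det := by
      rw [← hrr, updateRow_eq_self]
    have h2 : (A.updateRow r (∑ x, Pi.single x 1)).det =
        ∑ x, (A.updateRow r (Pi.single x 1)).det :=
      (detRowAlternating (n := V) (R := ℤ)).toMultilinearMap.map_update_sum Finset.univ r
        (fun x ↦ (Pi.single x 1 : V → ℤ)) A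
    rw [h1, h2, Finset.sum_congr rfl fun x _ ↦ hD x, Finset.sum_const, Finset.card_univ,
      nsmul_eq_mul]
  set A' := A.updateRow r (Pi.single r 1) with hA'
  have hspan (x : V) : ∃ c : V → ℤ, c ᵥ* A' = Pi.single x 1 := by
    refine hconn (fun x ↦ ∃ c : V → ℤ, c ᵥ* A' = Pi.single x 1) (fun e he ↦ ?_) ?_ x
    · obtain ⟨v, hv⟩ := hS e he
      have hvr : v ≠ r := by
        rintro rfl
        simp [hr] at hv
      have h1 : Pi.single v 1 ᵥ* A' = Pi.single (src e) 1 - Pi.single (tgt e) 1 := by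
        rw [single_one_vecMul, ← hrow hv]
        exact updateRow_ne hvr
      constructor
      · rintro ⟨c, h⟩
        exact ⟨c - Pi.single v 1, by rw [sub_vecMul, h, h1]; abel⟩
      · rintro ⟨c, h⟩
        exact ⟨c + Pi.single v 1, by rw [add_vecMul, h, h1]; abel⟩
    · refine ⟨Pi.single r 1, ?_⟩
      rw [single_one_vecMul]
      exact updateRow_self
  choose B hB using hspan
  have hBA : of B * A' = 1 := by
    ext x y
    have := congrFun (hB x) y
    rw [mul_apply_eq_vecMul, one_apply]
    refine this.trans ?_
    simp [Pi.single_apply, eq_comm]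
  have hunit : IsUnit A'.det := by
    refine IsUnit.of_mul_eq_one_right (of B).det ?_
    rw [← det_mul, hBA, det_one]
  rw [hdet, mul_pow, sq A'.det, Int.isUnit_mul_self hunit, mul_one]

lemma card_injective_image_eq {X : Type*} [DecidableEq X] [Fintype X] (T : Finset X)
    (hT : T.card = Fintype.card V) :
    (Finset.univ.filter fun f : V → X ↦ Function.Injective f ∧ Finset.univ.image f = T).card =
      (Fintype.card V).factorial := by
  have h : Fintype.card (V ↪ T) = (Fintype.card V).factorial := by
    rw [Fintype.card_embedding_eq, Fintype.card_coe, hT, Nat.descFactorial_self]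
  rw [← h, ← Finset.card_univ]
  symm
  refine Finset.card_bij (fun e _ v ↦ (e v : X)) ?_ ?_ ?_
  · intro e _
    have hinj : Function.Injective fun v ↦ (e v : X) := Subtype.val_injective.comp e.injective
    simp only [Finset.mem_filter, Finset.mem_univ, true_and]
    refine ⟨hinj, Finset.eq_of_subset_of_card_le ?_ ?_⟩
    · intro x hx
      obtain ⟨v, -, rfl⟩ := Finset.mem_image.1 hx
      exact (e v).2
    · rw [Finset.card_image_of_injective _ hinj, hT, Finset.card_univ]
  · intro e _ e' _ h
    ext v
    exact congrFun h v
  · intro f hf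
    simp only [Finset.mem_filter, Finset.mem_univ, true_and] at hf
    have hmem (v : V) : f v ∈ T := hf.2 ▸ Finset.mem_image_of_mem f (Finset.mem_univ v)
    exact ⟨⟨fun v ↦ ⟨f v, hmem v⟩, fun v w hvw ↦ hf.1 (congrArg Subtype.val hvw)⟩,
      Finset.mem_univ _, rfl⟩

open Classical Matrix in
/-- The **matrix-tree theorem**: the determinant of the sum of the Laplacian and the all-ones matrix
counts the connected spanning subgraphs which have one edge less than there are vertices. -/
theorem det_augmentedIncidence_transpose_mul [Fintype E] [Nonempty V] (src tgt : E → V) :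
    ((augmentedIncidence ℤ src tgt)ᵀ * augmentedIncidence ℤ src tgt).det =
      (Fintype.card V : ℤ) ^ 2 * (Finset.univ.filter fun S : Finset E ↦
        S.card + 1 = Fintype.card V ∧ (edgeGraph src tgt S).Connected).card := by
  set 𝒮 := Finset.univ.filter fun S : Finset E ↦
        S.card + 1 = Fintype.card V ∧ (edgeGraph src tgt S).Connected with h𝒮
  set 𝓕 := Finset.univ.filter fun f : V → Option E ↦ Function.Injective f ∧ (∃ v, f v = none) ∧
    (edgeGraph src tgt (Finset.univ.image f).eraseNone).Connected with h𝓕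
  have hdet (f : V → Option E) : ((augmentedIncidence ℤ src tgt).submatrix f id).det ^ 2 =
      if f ∈ 𝓕 then (Fintype.card V : ℤ) ^ 2 else 0 := by
    split_ifs with hf
    · simp only [h𝓕, Finset.mem_filter, Finset.mem_univ, true_and] at hf
      obtain ⟨hinj, ⟨r, hr⟩, hc⟩ := hf
      exact det_augmentedIncidence_sq_of_connected (fun e he ↦ by simpa using he) hr hc
    · by_contra hne
      have hne : ((augmentedIncidence ℤ src tgt).submatrix f id).det ≠ 0 := by
        rintro h
        simp [h] at hne
      refine hf ?_
      simp only [h𝓕, Finset.mem_filter, Finset.mem_univ, true_and]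
      exact ⟨injective_of_det_augmentedIncidence_ne_zero hne,
        exists_eq_none_of_det_augmentedIncidence_ne_zero hne,
        connected_of_det_augmentedIncidence_ne_zero (fun v e hv ↦ by simpa using ⟨v, hv⟩) hne⟩
  have hfib (f : V → Option E) (S : Finset E) :
      ((∃ v, f v = none) ∧ (Finset.univ.image f).eraseNone = S) ↔
        Finset.univ.image f = S.insertNone := by
    constructor
    · rintro ⟨⟨r, hr⟩, rfl⟩
      rw [Finset.insertNone_eraseNone, Finset.insert_eq_of_mem]
      exact hr ▸ Finset.mem_image_of_mem f (Finset.mem_univ r)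
    · intro h
      rw [h, Finset.eraseNone_insertNone]
      have : none ∈ Finset.univ.image f := h ▸ Finset.none_mem_insertNone
      simpa using this
  -- Each edge set `S`, completed by `none`, is enumerated by `|V|!` injective families; this factor
  -- cancels the one in Cauchy–Binet.
  have hcard : 𝓕.card = 𝒮.card * (Fintype.card V).factorial := by
    have hmaps : ∀ f ∈ 𝓕, (Finset.univ.image f).eraseNone ∈ 𝒮 := by
      intro f hf
      simp only [h𝓕, h𝒮, Finset.mem_filter, Finset.mem_univ, true_and] at hf ⊢
      refine ⟨?_, hf.2.2⟩
      have := congrArg Finset.card ((hfib f _).1 ⟨hf.2.1, rfl⟩)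
      rw [Finset.card_insertNone, Finset.card_image_of_injective _ hf.1, Finset.card_univ] at this
      exact this.symm
    rw [Finset.card_eq_sum_card_fiberwise hmaps, ← smul_eq_mul, ← Finset.sum_const]
    refine Finset.sum_congr rfl fun S hS ↦ ?_
    simp only [h𝒮, Finset.mem_filter, Finset.mem_univ, true_and] at hS
    rw [← card_injective_image_eq S.insertNone (by rw [Finset.card_insertNone, hS.1])]
    congr 1
    ext f
    simp only [h𝓕, Finset.mem_filter, Finset.mem_univ, true_and, ← hfib]
    constructor
    · rintro ⟨⟨h₁, h₂, -⟩, h₃⟩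
      exact ⟨h₁, h₂, h₃⟩
    · rintro ⟨h₁, h₂, rfl⟩
      exact ⟨⟨h₁, h₂, hS.2⟩, rfl⟩
  have h := factorial_mul_det_transpose_mul (augmentedIncidence ℤ src tgt)
    (augmentedIncidence ℤ src tgt)
  rw [Finset.sum_congr rfl fun f _ ↦ (sq _).symm.trans (hdet f), Finset.sum_ite_mem,
    Finset.univ_inter, Finset.sum_const, hcard, nsmul_eq_mul] at h
  refine mul_left_cancel₀ (Nat.cast_ne_zero.2 (Nat.factorial_ne_zero (Fintype.card V))) (h.trans ?_)
  push_cast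
  ring

end MatrixTree

/-! ### Spanning trees of a multigraph as edge sets -/

namespace Graph

variable {α β : Type*}

lemma exists_injective_toSimpleGraph_edgeSet (T : Graph α β) :
    ∃ φ : T.toSimpleGraph.edgeSet → T.edgeSet, Function.Injective φ ∧
      ∀ (p : T.toSimpleGraph.edgeSet) (x y : T.vertexSet), (p : Sym2 T.vertexSet) = s(x, y) → T.IsLink (φ p) x y := by
  have h (p : T.toSimpleGraph.edgeSet) : ∃ e : T.edgeSet,
      ∀ x y : T.vertexSet, (p : Sym2 T.vertexSet) = s(x, y) → T.IsLink e x y := by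
    obtain ⟨p, hp⟩ := p
    induction p with
    | h x y =>
      obtain ⟨-, e, he⟩ := hp
      refine ⟨⟨e, he.edge_mem⟩, fun x' y' h ↦ ?_⟩
      rcases Sym2.eq_iff.1 h with ⟨rfl, rfl⟩ | ⟨rfl, rfl⟩
      · exact he
      · exact he.symm
  choose φ hφ using h
  refine ⟨φ, fun p q hpq ↦ ?_, hφ⟩
  have hp := hφ p
  have hq := hφ q
  obtain ⟨p, hp'⟩ := p
  obtain ⟨q, hq'⟩ := q
  induction p with
  | h x y =>
    induction q with
    | h z w =>
      have h₁ := hp x y rfl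
      have h₂ := hq z w rfl
      rw [← hpq] at h₂
      have := h₁.isLink_iff_sym2_eq.1 h₂
      refine Subtype.ext (Sym2.eq_iff.2 ?_)
      simpa [Subtype.ext_iff] using this

/-- A connected underlying simple graph has at least `|V| - 1` edges and injects into the edges of
`T`. Equality makes the injection bijective, which excludes loops and parallel edges. -/
lemma isTree_iff_connected_and_ncard [Finite α] [Finite β] (T : Graph α β) :
    T.IsTree ↔ T.toSimpleGraph.Connected ∧ T.edgeSet.ncard + 1 = T.vertexSet.ncard := by
  obtain ⟨φ, hinj, hφ⟩ := T.exists_injective_toSimpleGraph_edgeSet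
  have hsurj (h : T.Simple) : Function.Surjective φ := by
    rintro ⟨e, he⟩
    obtain ⟨x, y, hxy⟩ := T.exists_isLink_of_mem_edgeSet he
    have hadj : T.toSimpleGraph.Adj ⟨x, hxy.left_mem⟩ ⟨y, hxy.right_mem⟩ :=
      (T.toSimpleGraph_adj_iff _ _).2 hxy.adj
    exact ⟨⟨s(_, _), hadj⟩, Subtype.ext ((hφ ⟨s(_, _), hadj⟩ _ _ rfl).eq hxy)⟩
  rw [IsTree, SimpleGraph.isTree_iff_connected_and_card, ← Nat.card_coe_set_eq,
    ← Nat.card_coe_set_eq]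
  constructor
  · rintro ⟨h, hc, hcard⟩
    exact ⟨hc, by rw [← Nat.card_eq_of_bijective φ ⟨hinj, hsurj h⟩, hcard]⟩
  · rintro ⟨hc, hcard⟩
    have h₁ := hc.card_vert_le_card_edgeSet_add_one
    have h₂ := Nat.card_le_card_of_injective φ hinj
    have h₃ : Nat.card T.toSimpleGraph.edgeSet = Nat.card T.edgeSet := by omega
    have hbij : Function.Bijective φ := (Nat.bijective_iff_injective_and_card φ).2 ⟨hinj, h₃⟩
    have key {e : β} {x y : α} (h : T.IsLink e x y) :
        ∃ h' : T.toSimpleGraph.Adj ⟨x, h.left_mem⟩ ⟨y, h.right_mem⟩,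
          e = φ ⟨s(⟨x, h.left_mem⟩, ⟨y, h.right_mem⟩), h'⟩ := by
      obtain ⟨⟨p, hp⟩, hpe⟩ := hbij.2 ⟨e, h.edge_mem⟩
      have hp' := hφ ⟨p, hp⟩
      induction p with
      | h z w =>
        have h' := hp' z w rfl
        rw [hpe] at h'
        have hzw : s(z, w) = s(⟨x, h.left_mem⟩, ⟨y, h.right_mem⟩) := by
          have := h'.isLink_iff_sym2_eq.1 h
          refine Sym2.eq_iff.2 ?_
          simpa [Subtype.ext_iff] using this
        refine ⟨by rw [← SimpleGraph.mem_edgeSet, ← hzw]; exact hp, ?_⟩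
        simp only [← hzw, hpe]
    refine ⟨{ not_isLoopAt := fun e x h ↦ ?_, eq_of_isLink := fun e f x y he hf ↦ ?_ }, hc, by omega⟩
    · exact (key (e := e) (x := x) (y := x) h).1.ne rfl
    · obtain ⟨h, he⟩ := key he
      obtain ⟨h', hf⟩ := key hf
      rw [he, hf]

open Classical in
/-- The number of spanning trees is the number of the connected edge sets with one edge less than
there are vertices. -/
theorem numSpanningTrees_eq_card {V E : Type*} [Fintype V] [Fintype E] (G : Graph V E)
    (src tgt : E → V) (hV : G.vertexSet = Set.univ) (hG : ∀ e x y, G.IsLink e x y ↔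
      (x = src e ∧ y = tgt e) ∨ (y = src e ∧ x = tgt e)) :
    G.numSpanningTrees = (Finset.univ.filter fun S : Finset E ↦
      S.card + 1 = Fintype.card V ∧ (edgeGraph src tgt S).Connected).card := by
  have hE : G.edgeSet = Set.univ :=
    Set.eq_univ_of_forall fun e ↦ ((hG e (src e) (tgt e)).2 (Or.inl ⟨rfl, rfl⟩)).edge_mem
  have htree (S : Finset E) : (G.restrict S).IsTree ↔
      S.card + 1 = Fintype.card V ∧ (edgeGraph src tgt S).Connected := by
    rw [isTree_iff_connected_and_ncard, and_comm]
    refine and_congr ?_ ?_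
    · rw [edgeSet_restrict, vertexSet_restrict, hE, hV, Set.univ_inter, Set.ncard_coe_finset,
        Set.ncard_univ, Nat.card_eq_fintype_card]
    · have e : (G.restrict (S : Set E)).toSimpleGraph ≃g edgeGraph src tgt S :=
        { toEquiv := (Equiv.setCongr hV).trans (Equiv.Set.univ V)
          map_rel_iff' := by
            rintro ⟨x, hx⟩ ⟨y, hy⟩
            simp only [edgeGraph, SimpleGraph.fromRel_adj, toSimpleGraph_adj, Adj, restrict_isLink, hG, ne_eq,
              Subtype.mk.injEq, Finset.mem_coe]
            refine and_congr_right fun _ ↦ ?_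
            constructor
            · rintro (⟨e, he, rfl, rfl⟩ | ⟨e, he, rfl, rfl⟩)
              · exact ⟨e, he, Or.inl ⟨rfl, rfl⟩⟩
              · exact ⟨e, he, Or.inr ⟨rfl, rfl⟩⟩
            · rintro ⟨e, he, ⟨rfl, rfl⟩ | ⟨rfl, rfl⟩⟩
              · exact Or.inl ⟨e, he, rfl, rfl⟩
              · exact Or.inr ⟨e, he, rfl, rfl⟩ }
      exact e.connected_iff
  have himage : {T : Graph V E | T.IsSpanningSubgraph G ∧ T.IsTree} =
      (fun S : Finset E ↦ G.restrict (S : Set E)) '' (Finset.univ.filter fun S : Finset E ↦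
        S.card + 1 = Fintype.card V ∧ (edgeGraph src tgt S).Connected : Finset (Finset E)) := by
    ext T
    simp only [Set.mem_ofPred_eq, Set.mem_image, Finset.coe_filter, Finset.mem_univ, true_and,
      ← htree]
    constructor
    · rintro ⟨hT, htr⟩
      have : G.restrict (T.edgeSet.toFinset : Set E) = T := by
        rw [Set.coe_toFinset]
        refine Compatible.ext hT.vertexSet_eq.symm ?_
          (Compatible.of_le_le (G := G) restrict_le hT.le)
        rw [edgeSet_restrict, hE, Set.univ_inter]
      exact ⟨T.edgeSet.toFinset, by rwa [this], this⟩
    · rintro ⟨S, hS, rfl⟩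
      exact ⟨⟨restrict_le, rfl⟩, hS⟩
  rw [numSpanningTrees, himage, Set.ncard_image_of_injective, Set.ncard_coe_finset]
  intro S S' h
  have := congrArg edgeSet h
  simpa [hE] using this

end Graph

/-! ### Spectrum of the circulant graph -/

section Circulant

variable {n : ℕ} [NeZero n] {k : ℕ}

lemma card_sq_mul_numSpanningTrees (s : Fin k → ℕ) :
    ((n : ℤ) ^ 2 * (circulantMultigraph n s).numSpanningTrees : ℤ) =
      ((augmentedIncidence ℤ (fun e : ZMod n × Fin k ↦ e.1) fun e ↦ e.1 + s e.2).transpose *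
        augmentedIncidence ℤ (fun e : ZMod n × Fin k ↦ e.1) fun e ↦ e.1 + s e.2).det := by
  rw [det_augmentedIncidence_transpose_mul, ZMod.card, Graph.numSpanningTrees_eq_card
    (circulantMultigraph n s) (fun e ↦ e.1) (fun e ↦ e.1 + s e.2) rfl fun _ _ _ ↦ Iff.rfl, ZMod.card]
  congr!

/-- The character table of `ZMod n`. -/
noncomputable def characterTable (n : ℕ) [NeZero n] : Matrix (ZMod n) (ZMod n) ℂ :=
  Matrix.of fun x j ↦ ZMod.stdAddChar (x * j)

open Matrix in
-- Orthogonality of characters makes the conjugate transpose an inverse up to the factor `n`.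
lemma det_characterTable_ne_zero : (characterTable n).det ≠ 0 := by
  have h : characterTable n * (of fun j y ↦ ZMod.stdAddChar (-(y * j)) : Matrix _ _ ℂ) =
      (n : ℂ) • 1 := by
    ext x y
    rw [mul_apply]
    have (j : ZMod n) : characterTable n x j * (of fun j y ↦ ZMod.stdAddChar (-(y * j))
        : Matrix _ _ ℂ) j y = ZMod.stdAddChar (j * (x - y)) := by
      simp only [characterTable, of_apply]
      rw [← AddChar.map_add_eq_mul]
      ring_nf
    rw [Finset.sum_congr rfl fun j _ ↦ this j,
      AddChar.sum_mulShift _ (ZMod.isPrimitive_stdAddChar n), ZMod.card]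
    simp [one_apply, sub_eq_zero]
  intro h0
  have := congrArg det h
  rw [det_mul, h0, zero_mul, det_smul, det_one, mul_one] at this
  exact pow_ne_zero _ (Nat.cast_ne_zero.2 (NeZero.ne n)) this.symm

open Matrix in
-- The matrix is `L + J`, and the characters are eigenvectors. `J` contributes `n` at the trivial
-- character, where `L` vanishes, and `0` at the others.
lemma det_augmentedIncidence_circulant (s : Fin k → ℕ) :
    ((augmentedIncidence ℂ (fun e : ZMod n × Fin k ↦ e.1) fun e ↦ e.1 + s e.2).transpose *
      augmentedIncidence ℂ (fun e : ZMod n × Fin k ↦ e.1) fun e ↦ e.1 + s e.2).det =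
    n * ∏ j ∈ Finset.univ.erase (0 : ZMod n), ∑ i, (2 - (ZMod.stdAddChar j ^ s i +
        (ZMod.stdAddChar j)⁻¹ ^ s i) : ℂ) := by
  set A := augmentedIncidence ℂ (fun e : ZMod n × Fin k ↦ e.1) fun e ↦ e.1 + s e.2 with hA
  set ev : ZMod n → ℂ := fun j ↦ if j = 0 then n else ∑ i, (2 - (ZMod.stdAddChar j ^ s i +
        (ZMod.stdAddChar j)⁻¹ ^ s i) : ℂ) with hev
  have hdiag : Aᵀ * A * characterTable n = characterTable n * diagonal ev := by
    ext x j
    rw [mul_diagonal, Matrix.mul_assoc, mul_apply, Fintype.sum_option]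
    have hnone : (A * characterTable n) none j = if j = 0 then (n : ℂ) else 0 := by
      have h₁ := augmentedIncidence_none_dotProduct (src := fun e : ZMod n × Fin k ↦ e.1)
        (tgt := fun e ↦ e.1 + s e.2) (fun y ↦ characterTable n y j)
      refine h₁.trans ?_
      simp only [characterTable, of_apply]
      rw [AddChar.sum_mulShift _ (ZMod.isPrimitive_stdAddChar n), ZMod.card]
      simp
    have hsome (e : ZMod n × Fin k) : (A * characterTable n) (some e) j =
        ZMod.stdAddChar (e.1 * j) * (1 - ZMod.stdAddChar j ^ s e.2) := by
      have h₁ := augmentedIncidence_some_dotProduct (src := fun e : ZMod n × Fin k ↦ e.1)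
        (tgt := fun e ↦ e.1 + s e.2) e (fun y ↦ characterTable n y j)
      refine h₁.trans ?_
      simp only [characterTable, of_apply]
      rw [add_mul, AddChar.map_add_eq_mul, ← nsmul_eq_mul, AddChar.map_nsmul_eq_pow]
      ring
    have hj : (ZMod.stdAddChar j : ℂ) ≠ 0 := (ZMod.stdAddChar (N := n)).val_isUnit j |>.ne_zero
    have hterm (i : Fin k) : ∑ y : ZMod n, Aᵀ x (some (y, i)) *
        (A * characterTable n) (some (y, i)) j = characterTable n x j *
          (2 - (ZMod.stdAddChar j ^ s i + (ZMod.stdAddChar j)⁻¹ ^ s i)) := by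
      -- For jump `i`, the vertex `x` is the source of edge `(x, i)` and the target of `(x - sᵢ,
      -- i)`.
      have h₁ (y : ZMod n) : Aᵀ x (some (y, i)) = (if x = y then 1 else 0) -
          if x - s i = y then 1 else 0 := by
        simp only [transpose_apply, hA, augmentedIncidence, Pi.sub_apply, Pi.single_apply,
          sub_eq_iff_eq_add]
      simp only [h₁, hsome, sub_mul, ite_mul, one_mul, zero_mul, Finset.sum_sub_distrib,
        Finset.sum_ite_eq, Finset.mem_univ, if_true]
      rw [AddChar.map_sub_eq_div, ← nsmul_eq_mul, AddChar.map_nsmul_eq_pow, inv_pow, characterTable,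
        of_apply]
      field_simp
      ring
    rw [Fintype.sum_prod_type_right, Finset.sum_congr rfl fun i _ ↦ hterm i, ← Finset.mul_sum,
      hnone]
    simp only [hev, transpose_apply]
    split_ifs with h0
    · subst h0
      simp [hA, augmentedIncidence, characterTable]
      ring
    · simp
  have hdet := congrArg det hdiag
  rw [det_mul, mul_comm, det_mul, det_diagonal] at hdet
  rw [mul_left_cancel₀ det_characterTable_ne_zero hdet,
    ← Finset.mul_prod_erase Finset.univ ev (Finset.mem_univ 0)]
  congr 1
  · simp [hev]
  · refine Finset.prod_congr rfl fun j hj ↦ ?_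
    simp only [hev, if_neg (Finset.ne_of_mem_erase hj)]

open Matrix in
lemma augmentedIncidence_map_intCast {V E : Type*} [Fintype V] [DecidableEq V] (R : Type*)
    [CommRing R] (src tgt : E → V) :
    (augmentedIncidence ℤ src tgt).map (Int.castRingHom R) = augmentedIncidence R src tgt := by
  ext e v
  cases e with
  | none => simp [augmentedIncidence]
  | some e => simp [augmentedIncidence, Pi.single_apply]

theorem mul_numSpanningTrees_circulantMultigraph (s : Fin k → ℕ) :
    (n * (circulantMultigraph n s).numSpanningTrees : ℂ) =
      ∏ j ∈ Finset.univ.erase (0 : ZMod n), ∑ i, (2 - (ZMod.stdAddChar j ^ s i +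
        (ZMod.stdAddChar j)⁻¹ ^ s i) : ℂ) := by
  have hn : (n : ℂ) ≠ 0 := Nat.cast_ne_zero.2 (NeZero.ne n)
  refine mul_left_cancel₀ hn ?_
  rw [← det_augmentedIncidence_circulant, ← augmentedIncidence_map_intCast,
    ← Matrix.transpose_map, ← Matrix.map_mul, ← RingHom.mapMatrix_apply, ← RingHom.map_det,
    ← card_sq_mul_numSpanningTrees]
  simp
  ring

end Circulant

/-! ### The main theorem -/

theorem theorem4p1 (k : ℕ) (hk : 1 ≤ k) (s : Fin k → ℕ) (hpos : ∀ i, 1 ≤ s i)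
    (hs : StrictMono s) :
    ∃ P Q : ℤ[X], Q.coeff 0 ≠ 0 ∧
      -- the generating function is `P / Q`
      (Q : PowerSeries ℤ) * spanningTreeSeries s = (P : PowerSeries ℤ) ∧
      -- `P(1/x) / Q(1/x) = P(x) / Q(x)` as rational functions
      aeval (RatFunc.X⁻¹ : RatFunc ℚ) P / aeval (RatFunc.X⁻¹ : RatFunc ℚ) Q =
        aeval (RatFunc.X : RatFunc ℚ) P / aeval (RatFunc.X : RatFunc ℚ) Q := by
  obtain ⟨f, hf, h⟩ := exists_evenExpSum_prod_stdAddChar hk hpos hs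
  refine IsPalindromicRational.exists_aeval_inv_eq (IsPalindromicRational.of_map (K := ℂ) ?_)
  convert! isPalindromicRational_mk_mul hf using 1
  ext n
  rw [PowerSeries.coeff_map, spanningTreeSeries, PowerSeries.coeff_mk, PowerSeries.coeff_mk]
  split_ifs with hn
  · simp [hn]
  · have : NeZero n := ⟨hn⟩
    -- `n τ(n) = n² f(n)` gives `τ(n) = n f(n)`.
    refine mul_left_cancel₀ (Nat.cast_ne_zero.2 hn : (n : ℂ) ≠ 0) ?_
    have := mul_numSpanningTrees_circulantMultigraph (n := n) s
    rw [h] at this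
    rw [eq_intCast, Int.cast_natCast, this]
    ring
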